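/- Let $m\ge 0$ be an integer. For a subspace $U\subseteq\mathbb F_2^{2m}$ let $U^\perp=\{z: z\cdot u=0\ \forall u\in U\}$, and let $CS(U)$ be a fixed set of coset representatives of $U$ in $\mathbb F_2^{2m}$. Let $G(2m,m)$ be the set of $m$-dimensional subspaces of $\mathbb F_2^{2m}$, and for $W\in G(2m,m)$ and $x,z\in\mathbb F_2^{2m}$ let $$|W_{x,z}\rangle=\frac1{\sqrt{2^m}}\sum_{u\in W}(-1)^{z\cdot u}|x+u\rangle\in(\mathbb C^2)^{\otimes 2m}$$ be the coset state. In the coset guessing game with parameter $m$, Alice picks $W\in G(2m,m)$, $x\in CS(W)$ and $z\in CS(W^\perp)$ uniformly at random, gives the first $m$ qubits of $|W_{x,z}\rangle$ to Bob and the last $m$ to Charlie, and announces $W$ to both. A strategy consists, for each $W\in G(2m,m)$, of a POVM $\{B^W_{x}\}_{x\in CS(W)}$ on Bob's $m$ qubits and a POVM $\{C^W_{z}\}_{z\in CS(W^\perp)}$ on Charlie's $m$ qubits. Bob and Charlie win if Bob's outcome is $x$ and Charlie's outcome is $z$, so the winning probability of the strategy is $$\mathbb E_{W,x,z}\,\operatorname{Tr}\bigl[(B^W_x\otimes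 C^W_z)\,|W_{x,z}\rangle\langle W_{x,z}|\bigr].$$ Let $p_m$ be the supremum of the winning probability over all strategies, and for $0\le k\le n$ let $\binom nk_2=\prod_{j=0}^{k-1}\frac{2^{n-j}-1}{2^{k-j}-1}$. Then for every $m$ and every choice of the coset representatives, $$p_m\le\frac1{\binom{2m}{m}_2}\sum_{k=0}^m2^{k^2}\binom mk_2^2\Bigl(\frac12\Bigr)^k,$$ and the right-hand side is $\Theta(2^{-m})$ as $m\to\infty$. -/

import Mathlib

open scoped ComplexOrder Kronecker Matrix
open Asymptotics Filter

noncomputable section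

/-- The `𝔽₂`-vector space `𝔽₂ⁿ`. Its elements also label the computational basis of the
`n`-qubit space `(ℂ²)^{⊗ n}`, so that vectors of that space are functions `F2Vec n → ℂ` and
operators on it are matrices with rows and columns labelled by `F2Vec n`. -/
abbrev F2Vec (n : ℕ) : Type := Fin n → ZMod 2

/-- Linear subspaces of `𝔽₂ⁿ`. -/
abbrev F2Subspace (n : ℕ) : Type := Submodule (ZMod 2) (F2Vec n)

/-- The set `G(n, k)` of `k`-dimensional subspaces of `𝔽₂ⁿ`. -/
def Grass (n k : ℕ) : Type := {W : F2Subspace n // Module.finrank (ZMod 2) W = k}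

instance (n k : ℕ) : Finite (Grass n k) :=
  inferInstanceAs (Finite {W : F2Subspace n // Module.finrank (ZMod 2) W = k})

instance (n k : ℕ) : Fintype (Grass n k) := Fintype.ofFinite _

/-- The dual `W^⊥ = {z | z · u = 0 for all u ∈ W}`. -/
def dualSpace {n : ℕ} (W : F2Subspace n) : F2Subspace n where
  carrier := {z | ∀ u ∈ W, z ⬝ᵥ u = 0}
  zero_mem' := by
    intro u _
    simp
  add_mem' := by
    intro a b ha hb u hu
    rw [add_dotProduct, ha u hu, hb u hu, add_zero]
  smul_mem' := by
    intro c a ha u hu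
    rw [smul_dotProduct, ha u hu, smul_zero]

/-- `S` is a set of coset representatives of the subspace `U`: each coset of `U` contains exactly
one element of `S`. -/
def IsCosetReps {n : ℕ} (U : F2Subspace n) (S : Finset (F2Vec n)) : Prop :=
  ∀ v : F2Vec n, ∃! s : F2Vec n, s ∈ S ∧ v - s ∈ U

/-- The computational basis vector `|v⟩`. -/
def ket {n : ℕ} (v : F2Vec n) : F2Vec n → ℂ := Pi.single v 1

open Classical in
/-- The coset state `|W_{x,z}⟩ = 2^{-m/2} ∑_{u ∈ W} (-1)^{z · u} |x + u⟩` on `2m` qubits. The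
`m + m` qubits are the `m` of Bob followed by the `m` of Charlie. -/
def cosetState {m : ℕ} (W : Grass (m + m) m) (x z : F2Vec (m + m)) : F2Vec (m + m) → ℂ :=
  ((1 / Real.sqrt (2 ^ m) : ℝ) : ℂ) •
    ∑ u : F2Vec (m + m) with u ∈ W.1, ((-1 : ℂ) ^ (z ⬝ᵥ u).val) • ket (x + u)

/-- The rank-one operator `|ψ⟩⟨ψ|`. -/
def ketBra {n : ℕ} (ψ : F2Vec n → ℂ) : Matrix (F2Vec n) (F2Vec n) ℂ :=
  Matrix.vecMulVec ψ (star ψ)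

/-- The operator `B ⊗ C` on `2m` qubits, where `B` acts on the first `m` qubits and `C` on the
last `m` qubits. -/
def tensorOp {m : ℕ} (B C : Matrix (F2Vec m) (F2Vec m) ℂ) :
    Matrix (F2Vec (m + m)) (F2Vec (m + m)) ℂ :=
  Matrix.reindex (Fin.appendEquiv m m) (Fin.appendEquiv m m) (B ⊗ₖ C)

/-- A positive operator valued measure on `n` qubits with outcomes in the finite type `ι`. -/
structure POVM (n : ℕ) (ι : Type) [Fintype ι] where
  /-- The operator that belongs to an outcome. -/
  effect : ι → Matrix (F2Vec n) (F2Vec n) ℂ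
  posSemidef : ∀ i, (effect i).PosSemidef
  sum_eq_one : ∑ i, effect i = 1

/-- A strategy of Bob and Charlie: for each `W ∈ G(2m, m)`, Bob has a POVM on `m` qubits with
outcomes in `CS(W)`, and Charlie one on `m` qubits with outcomes in `CS(W^⊥)`. -/
structure Strategy (m : ℕ) (CS : F2Subspace (m + m) → Finset (F2Vec (m + m))) where
  bob : ∀ W : Grass (m + m) m, POVM m (CS W.1)
  charlie : ∀ W : Grass (m + m) m, POVM m (CS (dualSpace W.1))

/-- The probability `Tr[(B_x^W ⊗ C_z^W) |W_{x,z}⟩⟨W_{x,z}|]` that Bob outputs `x` and Charlie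
outputs `z` when Alice has chosen `W`, `x ∈ CS(W)` and `z ∈ CS(W^⊥)`. (The trace is a real
number.) -/
def condWinProb {m : ℕ} {CS : F2Subspace (m + m) → Finset (F2Vec (m + m))} (S : Strategy m CS)
    (W : Grass (m + m) m) (x : CS W.1) (z : CS (dualSpace W.1)) : ℝ :=
  (Matrix.trace (tensorOp ((S.bob W).effect x) ((S.charlie W).effect z) *
    ketBra (cosetState W x.1 z.1))).re

/-- The winning probability of a strategy: the average of the above over uniformly random
`W ∈ G(2m, m)`, `x ∈ CS(W)` and `z ∈ CS(W^⊥)`. -/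
def winProb {m : ℕ} {CS : F2Subspace (m + m) → Finset (F2Vec (m + m))} (S : Strategy m CS) : ℝ :=
  (1 / (Fintype.card (Grass (m + m) m) : ℝ)) * ∑ W : Grass (m + m) m,
    (1 / (((CS W.1).card : ℝ) * ((CS (dualSpace W.1)).card : ℝ))) *
      ∑ x : CS W.1, ∑ z : CS (dualSpace W.1), condWinProb S W x z

/-- `p_m`: the supremum of the winning probability over all strategies. -/
def optWinProb (m : ℕ) (CS : F2Subspace (m + m) → Finset (F2Vec (m + m))) : ℝ :=
  sSup (Set.range fun S : Strategy m CS => winProb S)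

/-- The `q`-binomial coefficient `∏_{j < k} (q^{n-j} - 1) / (q^{k-j} - 1)`; for `j < k ≤ n` and
`q > 1` the exponents are true differences and the denominators are nonzero. -/
def qBinom (q : ℝ) (n k : ℕ) : ℝ :=
  ∏ j ∈ Finset.range k, (q ^ (n - j) - 1) / (q ^ (k - j) - 1)

/-- The bound `(1 / [2m choose m]_2) ∑_{k=0}^m 2^{k²} [m choose k]_2² 2^{-k}`. -/
def cosetBound (m : ℕ) : ℝ :=
  (1 / qBinom 2 (2 * m) m) *
    ∑ k ∈ Finset.range (m + 1), (2 : ℝ) ^ (k ^ 2) * qBinom 2 m k ^ 2 * (1 / 2) ^ k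

end

/-!
What Bob achieves alone bounds the winning probability: Charlie's effects satisfy `C_z ≤ 1`, so dropping
his answer only helps. For a fixed subspace `W`, averaging the coset states `|W_{x,z}⟩⟨W_{x,z}|`
over `z` gives the classical uniform mixture of the basis states `|v⟩` with `v ∈ x + W`: the
off-diagonal entries are character sums over `W^⊥`-cosets and vanish (`sum_cosetState_mul_star`).
So Bob has to guess the coset of a uniformly random `v = (a, b)` from `a` alone. Given `a`, at most
`|W ∩ (0 ⊕ 𝔽₂ᵐ)|` of the `2 ^ m` values of `b` lie in the coset that he names, whence his success
probability is at most `|W ∩ (0 ⊕ 𝔽₂ᵐ)| / 2 ^ m` (`sum_condWinProb_le`).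

All nonzero vectors lie in equally many `m`-dimensional subspaces, since the linear automorphisms
permute them transitively. This determines the mean of `|W ∩ (0 ⊕ 𝔽₂ᵐ)|` over `G(2m, m)`
(`sum_cardTail`), and the winning probability is at most `2 / (2 ^ m + 1)` (`winProb_le`).

The bound `cosetBound m` is this very number: sorting the `W` by the codimension `k` of the
intersection would give its sum over `k`. Instead of counting subspaces, `cosetBound_eq` evaluates
that sum algebraically by the `q`-Vandermonde identity. The order of growth `Θ(2^{-m})` is then
evident.
-/

/-! ### Gaussian binomial coefficients -/

lemma qBinom_zero_right (q : ℝ) (n : ℕ) : qBinom q n 0 = 1 := by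
  simp [qBinom]

lemma qBinom_eq_zero_of_lt (q : ℝ) {n k : ℕ} (h : n < k) : qBinom q n k = 0 :=
  Finset.prod_eq_zero (Finset.mem_range.2 h) (by simp)

lemma qBinom_succ_succ_eq_div_mul (q : ℝ) (n k : ℕ) :
    qBinom q (n + 1) (k + 1) = (q ^ (n + 1) - 1) / (q ^ (k + 1) - 1) * qBinom q n k := by
  unfold qBinom
  rw [Finset.prod_range_succ', mul_comm]
  simp

lemma pow_succ_sub_one_pos {q : ℝ} (hq : 1 < q) (k : ℕ) : 0 < q ^ (k + 1) - 1 :=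
  sub_pos.2 (one_lt_pow₀ hq k.succ_ne_zero)

/-- Valid for all `n` and `k`: if `n ≤ k`, then both sides are `0`. -/
lemma qBinom_succ_right_mul {q : ℝ} (hq : 1 < q) (n k : ℕ) :
    qBinom q n (k + 1) * (q ^ (k + 1) - 1) = qBinom q n k * (q ^ (n - k) - 1) := by
  induction n generalizing k with
  | zero => simp [qBinom_eq_zero_of_lt q k.succ_pos]
  | succ n ih =>
    have h0 := (pow_succ_sub_one_pos hq k).ne'
    cases k with
    | zero =>
      rw [qBinom_succ_succ_eq_div_mul, qBinom_zero_right, qBinom_zero_right]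
      field_simp
      simp
    | succ k =>
      have h1 := (pow_succ_sub_one_pos hq k).ne'
      rw [qBinom_succ_succ_eq_div_mul, qBinom_succ_succ_eq_div_mul, Nat.add_sub_add_right]
      have := ih k
      field_simp
      linear_combination (q ^ (n + 1) - 1) * this

/-- The `q`-Pascal rule with the power of `q` on the term with the larger lower index. -/
lemma qBinom_succ_succ {q : ℝ} (hq : 1 < q) (n k : ℕ) :
    qBinom q (n + 1) (k + 1) = qBinom q n k + q ^ (k + 1) * qBinom q n (k + 1) := by
  rcases lt_or_ge n k with h | h
  · simp [qBinom_eq_zero_of_lt q h, qBinom_eq_zero_of_lt q (Nat.succ_lt_succ h),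
      qBinom_eq_zero_of_lt q (Nat.lt_succ_of_lt h)]
  · have h0 := (pow_succ_sub_one_pos hq k).ne'
    have h1 := qBinom_succ_right_mul hq n k
    have h2 : q ^ (n + 1) = q ^ (k + 1) * q ^ (n - k) := by
      rw [← pow_add]; congr 1; omega
    rw [qBinom_succ_succ_eq_div_mul, h2]
    field_simp
    linear_combination -q ^ (k + 1) * h1

/-- The `q`-Pascal rule with the power of `q` on the term with the smaller lower index. -/
lemma qBinom_succ_succ' {q : ℝ} (hq : 1 < q) (n k : ℕ) :
    qBinom q (n + 1) (k + 1) = q ^ (n - k) * qBinom q n k + qBinom q n (k + 1) := by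
  have h1 := qBinom_succ_right_mul hq n k
  rw [qBinom_succ_succ hq]
  linear_combination h1

/-- A `q`-Vandermonde identity, in the form in which no exponent involves a subtraction. -/
lemma sum_pow_mul_qBinom_mul_qBinom {q : ℝ} (hq : 1 < q) (m b d : ℕ) :
    ∑ k ∈ Finset.range (b + 1), q ^ (k * (k + d)) * qBinom q m (k + d) * qBinom q b k =
      qBinom q (m + b) (b + d) := by
  induction b generalizing d with
  | zero => simp [qBinom_zero_right]
  | succ b ih =>
    have key : ∀ k ∈ Finset.range (b + 1),
        q ^ ((k + 1) * (k + 1 + d)) * qBinom q m (k + 1 + d) * qBinom q (b + 1) (k + 1) =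
          q ^ (b + d + 1) * (q ^ (k * (k + (d + 1))) * qBinom q m (k + (d + 1)) * qBinom q b k) +
          q ^ ((k + 1) * (k + 1 + d)) * qBinom q m (k + 1 + d) * qBinom q b (k + 1) := by
      intro k hk
      have hkb : k ≤ b := Nat.lt_succ_iff.1 (Finset.mem_range.1 hk)
      have e : q ^ ((k + 1) * (k + 1 + d)) * q ^ (b - k) =
          q ^ (b + d + 1) * q ^ (k * (k + (d + 1))) := by
        rw [← pow_add, ← pow_add]
        congr 1
        obtain ⟨c, rfl⟩ := Nat.exists_eq_add_of_le hkb
        rw [Nat.add_sub_cancel_left]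
        ring
      rw [qBinom_succ_succ' hq b k, show k + (d + 1) = k + 1 + d by ring] at *
      linear_combination qBinom q m (k + 1 + d) * qBinom q b k * e
    have ih0 := ih d
    rw [Finset.sum_range_succ'] at ih0 ⊢
    rw [Finset.sum_congr rfl key, Finset.sum_add_distrib, ← Finset.mul_sum, ih (d + 1),
      Finset.sum_range_succ, qBinom_eq_zero_of_lt q b.lt_succ_self, ← add_assoc m b 1,
      show b + 1 + d = b + d + 1 by ring, qBinom_succ_succ hq, ← ih0]
    simp only [qBinom_zero_right, ← add_assoc]
    ring

lemma sum_pow_sq_mul_qBinom_sq {q : ℝ} (hq : 1 < q) (m : ℕ) :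
    (q ^ m + 1) * ∑ k ∈ Finset.range (m + 1), q ^ (k ^ 2) * qBinom q m k ^ 2 * (1 / q) ^ k =
      2 * qBinom q (2 * m) m := by
  cases m with
  | zero => simp [qBinom_zero_right]; norm_num
  | succ m =>
    have hq0 : q ≠ 0 := by positivity
    -- One factor `qBinom q (m + 1) k` is split by the Pascal rule, so that two Vandermonde sums
    -- appear.
    have key : ∀ k ∈ Finset.range (m + 1),
        q ^ ((k + 1) ^ 2) * qBinom q (m + 1) (k + 1) ^ 2 * (1 / q) ^ (k + 1) =
          q ^ (k * (k + 1)) * qBinom q (m + 1) (k + 1) * qBinom q m k +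
          q ^ ((k + 1) * (k + 1 + 0)) * qBinom q (m + 1) (k + 1 + 0) * qBinom q m (k + 1) := by
      intro k _
      have e : q ^ ((k + 1) ^ 2) * (1 / q) ^ (k + 1) = q ^ (k * (k + 1)) := by
        rw [show (k + 1) ^ 2 = k * (k + 1) + (k + 1) by ring, pow_add, mul_assoc, ← mul_pow,
          mul_one_div_cancel hq0, one_pow, mul_one]
      have e' : q ^ ((k + 1) * (k + 1 + 0)) = q ^ (k * (k + 1)) * q ^ (k + 1) := by
        rw [← pow_add]; congr 1; ring
      rw [mul_right_comm, e, e', sq, add_zero]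
      nth_rewrite 2 [qBinom_succ_succ hq]
      ring
    have v0 := sum_pow_mul_qBinom_mul_qBinom hq (m + 1) m 0
    rw [Finset.sum_range_succ'] at v0
    have hsum : ∑ k ∈ Finset.range (m + 1 + 1),
        q ^ (k ^ 2) * qBinom q (m + 1) k ^ 2 * (1 / q) ^ k =
          qBinom q (m + 1 + m) (m + 1) + qBinom q (m + 1 + m) m := by
      rw [Finset.sum_range_succ', Finset.sum_congr rfl key, Finset.sum_add_distrib,
        sum_pow_mul_qBinom_mul_qBinom hq, Finset.sum_range_succ,
        qBinom_eq_zero_of_lt q m.lt_succ_self]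
      simp only [qBinom_zero_right, add_zero, mul_zero] at v0 ⊢
      rw [← v0]
      simp [add_assoc]
    have hsymm : qBinom q (m + 1 + m) (m + 1) = qBinom q (m + 1 + m) m := by
      have h := qBinom_succ_right_mul hq (m + 1 + m) m
      rw [Nat.add_sub_cancel] at h
      exact mul_right_cancel₀ (pow_succ_sub_one_pos hq m).ne' h
    rw [hsum, show 2 * (m + 1) = m + 1 + m + 1 by ring, qBinom_succ_succ hq, hsymm]
    ring

lemma qBinom_pos {q : ℝ} (hq : 1 < q) {n k : ℕ} (h : k ≤ n) : 0 < qBinom q n k := by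
  refine Finset.prod_pos fun j hj ↦ ?_
  have hj := Finset.mem_range.1 hj
  exact div_pos (sub_pos.2 (one_lt_pow₀ hq (by omega))) (sub_pos.2 (one_lt_pow₀ hq (by omega)))

lemma cosetBound_eq (m : ℕ) : cosetBound m = 2 / (2 ^ m + 1) := by
  have h := sum_pow_sq_mul_qBinom_sq one_lt_two m
  have hpos := qBinom_pos one_lt_two (Nat.le_mul_of_pos_left m two_pos)
  unfold cosetBound
  rw [eq_div_iff (by positivity), mul_assoc, mul_comm _ ((2 : ℝ) ^ m + 1), h]
  field_simp

lemma cosetBound_isTheta : cosetBound =Θ[atTop] (fun m : ℕ => (1 : ℝ) / 2 ^ m) := by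
  have h1 : ∀ m : ℕ, (1 : ℝ) ≤ 2 ^ m := fun m ↦ one_le_pow₀ one_le_two
  refine ⟨IsBigO.of_bound 2 (Eventually.of_forall fun m ↦ ?_),
    IsBigO.of_bound 1 (Eventually.of_forall fun m ↦ ?_)⟩
  · rw [cosetBound_eq, Real.norm_of_nonneg (by positivity), Real.norm_of_nonneg (by positivity),
      mul_one_div]
    gcongr
    linarith
  · rw [cosetBound_eq, Real.norm_of_nonneg (by positivity), Real.norm_of_nonneg (by positivity),
      one_mul, div_le_div_iff₀ (by positivity) (by positivity)]
    linarith [h1 m]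

/-! ### Subspaces containing a given vector -/

/-- The linear automorphisms act transitively on the nonzero vectors of `𝔽₂ⁿ`. -/
lemma exists_linearEquiv_apply_eq {n : ℕ} {v w : F2Vec n} (hv : v ≠ 0) (hw : w ≠ 0) :
    ∃ e : F2Vec n ≃ₗ[ZMod 2] F2Vec n, e v = w := by
  have : MulAction.IsPretransitive (F2Vec n ≃ₗ[ZMod 2] F2Vec n)
      (Projectivization (ZMod 2) (F2Vec n)) :=
    MulAction.isPretransitive_of_is_two_pretransitive
  obtain ⟨e, he⟩ := MulAction.exists_smul_eq (F2Vec n ≃ₗ[ZMod 2] F2Vec n)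
    (Projectivization.mk (ZMod 2) v hv) (Projectivization.mk (ZMod 2) w hw)
  rw [Projectivization.smul_mk, Projectivization.mk_eq_mk_iff] at he
  obtain ⟨a, ha⟩ := he
  rw [Subsingleton.elim a 1, one_smul] at ha
  exact ⟨e, ha.symm⟩

/-- The number of `k`-dimensional subspaces of `𝔽₂ⁿ` that contain the vector `v`. -/
noncomputable def incidence (n k : ℕ) (v : F2Vec n) : ℕ :=
  Nat.card {W : Grass n k // v ∈ W.1}

lemma incidence_zero (n k : ℕ) : incidence n k 0 = Fintype.card (Grass n k) :=
  (Nat.card_congr (Equiv.subtypeUnivEquiv fun W ↦ W.1.zero_mem)).trans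
    Nat.card_eq_fintype_card

/-- The action of a linear automorphism on subspaces of a given dimension. -/
noncomputable def Grass.mapEquiv {n k : ℕ} (e : F2Vec n ≃ₗ[ZMod 2] F2Vec n) :
    Grass n k ≃ Grass n k :=
  (Submodule.orderIsoMapComap e).toEquiv.subtypeEquiv fun W ↦ by
    change _ ↔ Module.finrank (ZMod 2) (W.map e.toLinearMap) = k
    rw [LinearEquiv.finrank_map_eq]

lemma incidence_eq {n k : ℕ} {v w : F2Vec n} (hv : v ≠ 0) (hw : w ≠ 0) :
    incidence n k v = incidence n k w := by
  obtain ⟨e, rfl⟩ := exists_linearEquiv_apply_eq hv hw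
  refine Nat.card_congr ((Grass.mapEquiv e).subtypeEquiv fun W ↦ ?_)
  change v ∈ W.1 ↔ e v ∈ W.1.map e.toLinearMap
  simp

lemma card_of_finrank_eq {n k : ℕ} (W : Grass n k) : Nat.card W.1 = 2 ^ k := by
  rw [Module.natCard_eq_pow_finrank (K := ZMod 2), Nat.card_zmod, W.2]

lemma sum_incidence (n k : ℕ) :
    ∑ v, incidence n k v = Fintype.card (Grass n k) * 2 ^ k := by
  classical
  simp_rw [incidence, Nat.card_eq_fintype_card, Fintype.card_subtype, Finset.card_filter]
  rw [Finset.sum_comm]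
  simp_rw [← Finset.card_filter, ← Fintype.card_subtype]
  rw [Finset.sum_congr rfl fun W _ ↦ ?_, Finset.sum_const, smul_eq_mul, Finset.card_univ]
  exact (Nat.card_eq_fintype_card).symm.trans (card_of_finrank_eq W)

/-- Double counting of the pairs `v ∈ W` with `v ≠ 0`. -/
lemma incidence_mul {n k : ℕ} {v : F2Vec n} (hv : v ≠ 0) :
    (2 ^ n - 1 : ℝ) * incidence n k v = Fintype.card (Grass n k) * (2 ^ k - 1) := by
  have h := sum_incidence n k
  rw [← Finset.add_sum_erase _ _ (Finset.mem_univ 0), incidence_zero,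
    Finset.sum_congr rfl fun w hw ↦ incidence_eq (Finset.ne_of_mem_erase hw) hv,
    Finset.sum_const, Finset.card_erase_of_mem (Finset.mem_univ _), Finset.card_univ] at h
  simp only [Fintype.card_pi, ZMod.card, Finset.prod_const, Finset.card_univ, Fintype.card_fin,
    smul_eq_mul] at h
  have h' := congrArg (Nat.cast (R := ℝ)) h
  push_cast [Nat.one_le_two_pow] at h'
  linear_combination h'

/-- The number of vectors of `W` whose first `m` coordinates vanish. -/
noncomputable def cardTail {m : ℕ} (W : Grass (m + m) m) : ℕ :=
  Nat.card {b : F2Vec m // Fin.append 0 b ∈ W.1}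

lemma append_eq_zero_iff {m : ℕ} (b : F2Vec m) :
    (Fin.append 0 b : F2Vec (m + m)) = 0 ↔ b = 0 := by
  constructor
  · intro h
    ext i
    have := congrFun h (Fin.natAdd m i)
    rwa [Fin.append_right] at this
  · rintro rfl
    ext i
    refine Fin.addCases (fun i ↦ ?_) (fun i ↦ ?_) i
    · rw [Fin.append_left]; rfl
    · rw [Fin.append_right]; rfl

/-- The average of `cardTail` over `G(2m, m)` is `2 * 2 ^ m / (2 ^ m + 1)`. -/
lemma sum_cardTail (m : ℕ) :
    (2 ^ m + 1 : ℝ) * ∑ W : Grass (m + m) m, (cardTail W : ℝ) =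
      Fintype.card (Grass (m + m) m) * (2 * 2 ^ m) := by
  classical
  have hsum : ∑ W : Grass (m + m) m, cardTail W =
      ∑ b : F2Vec m, incidence (m + m) m (Fin.append 0 b) := by
    simp_rw [cardTail, incidence, Nat.card_eq_fintype_card, Fintype.card_subtype,
      Finset.card_filter]
    rw [Finset.sum_comm]
  have happ0 : (Fin.append 0 (0 : F2Vec m) : F2Vec (m + m)) = 0 := (append_eq_zero_iff 0).2 rfl
  rw [← Nat.cast_sum, hsum, ← Finset.add_sum_erase _ _ (Finset.mem_univ 0), happ0, incidence_zero]
  rcases Nat.eq_zero_or_pos m with rfl | hm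
  · rw [Finset.sum_eq_zero fun b hb ↦
      absurd (Subsingleton.elim b 0) (Finset.ne_of_mem_erase hb)]
    push_cast
    ring
  · have h1 : (1 : ℝ) < 2 ^ m := one_lt_pow₀ one_lt_two hm.ne'
    have hK : (2 ^ (m + m) - 1 : ℝ) * ∑ b ∈ Finset.univ.erase (0 : F2Vec m),
        (incidence (m + m) m (Fin.append 0 b) : ℝ) =
          (2 ^ m - 1) * (Fintype.card (Grass (m + m) m) * (2 ^ m - 1)) := by
      rw [Finset.mul_sum, Finset.sum_congr rfl fun b hb ↦ incidence_mul fun h ↦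
        Finset.ne_of_mem_erase hb ((append_eq_zero_iff b).1 h), Finset.sum_const,
        Finset.card_erase_of_mem (Finset.mem_univ _), Finset.card_univ]
      simp [Nat.one_le_two_pow]
    rw [pow_add] at hK
    push_cast
    refine mul_left_cancel₀ (sub_pos.2 h1).ne' ?_
    linear_combination hK

/-! ### Sums over coset representatives -/

namespace IsCosetReps

variable {n : ℕ} {U : F2Subspace n} {S : Finset (F2Vec n)}

lemma sum_ite (hS : IsCosetReps U S) [DecidablePred (· ∈ U)] (v : F2Vec n) {M : Type*}
    [AddCommMonoid M] (a : M) : ∑ s ∈ S, (if v - s ∈ U then a else 0) = a := by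
  obtain ⟨s, ⟨hs, hsU⟩, huniq⟩ := hS v
  rw [Finset.sum_eq_single_of_mem s hs fun t ht hts ↦ if_neg fun h ↦ hts (huniq t ⟨ht, h⟩),
    if_pos hsU]

/-- The sum of a function that is constant on cosets is a multiple of its sum over a set of coset
representatives. -/
lemma card_smul_sum (hS : IsCosetReps U S) {M : Type*} [AddCommMonoid M] (g : F2Vec n → M)
    (hg : ∀ v, ∀ u ∈ U, g (v + u) = g v) :
    Nat.card U • ∑ s ∈ S, g s = ∑ v, g v := by
  classical
  calc Nat.card U • ∑ s ∈ S, g s = ∑ s ∈ S, ∑ v, if v - s ∈ U then g v else 0 := by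
        rw [Finset.smul_sum]
        refine Finset.sum_congr rfl fun s _ ↦ ?_
        rw [← Equiv.sum_comp (Equiv.addLeft s)]
        simp only [Equiv.coe_addLeft, add_sub_cancel_left]
        rw [← Finset.sum_filter, Finset.sum_congr rfl fun u hu ↦ hg s u (Finset.mem_filter.1 hu).2,
          Finset.sum_const, Nat.card_eq_fintype_card, Fintype.card_subtype]
    _ = ∑ v, g v := by
        rw [Finset.sum_comm]
        exact Finset.sum_congr rfl fun v _ ↦ hS.sum_ite v _

lemma card_mul (hS : IsCosetReps U S) : Nat.card U * S.card = 2 ^ n := by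
  simpa using hS.card_smul_sum (fun _ ↦ (1 : ℕ)) fun _ _ _ ↦ rfl

lemma nonempty (hS : IsCosetReps U S) : S.Nonempty :=
  let ⟨s, ⟨hs, _⟩, _⟩ := hS 0
  ⟨s, hs⟩

end IsCosetReps

/-! ### Characters of `𝔽₂ⁿ` and averages of coset states -/

/-- The sign `(-1)^a`. -/
def zmodSign (a : ZMod 2) : ℂ := (-1) ^ a.val

lemma zmodSign_zero : zmodSign 0 = 1 := by simp [zmodSign]

lemma zmodSign_one : zmodSign 1 = -1 := by simp [zmodSign, ZMod.val_one]

lemma zmodSign_add (a b : ZMod 2) : zmodSign (a + b) = zmodSign a * zmodSign b := by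
  have h : ∀ a : ZMod 2, a = 0 ∨ a = 1 := by decide
  rcases h a with rfl | rfl <;> rcases h b with rfl | rfl <;>
    simp [zmodSign_zero, zmodSign_one, show (1 + 1 : ZMod 2) = 0 from rfl]

lemma star_zmodSign (a : ZMod 2) : star (zmodSign a) = zmodSign a := by
  simp [zmodSign]

lemma sum_zmodSign_dotProduct {n : ℕ} {u : F2Vec n} (hu : u ≠ 0) :
    ∑ z : F2Vec n, zmodSign (z ⬝ᵥ u) = 0 := by
  obtain ⟨i, hi⟩ := Function.ne_iff.1 hu
  have hi : u i = 1 := Fin.eq_one_of_ne_zero _ hi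
  have h : ∑ z : F2Vec n, zmodSign (z ⬝ᵥ u) = -∑ z : F2Vec n, zmodSign (z ⬝ᵥ u) := by
    -- Translation by the `i`-th unit vector flips every sign.
    conv_lhs => rw [← Equiv.sum_comp (Equiv.addRight (Pi.single i (1 : ZMod 2)))]
    simp [add_dotProduct, zmodSign_add, hi, zmodSign_one]
  exact self_eq_neg.1 h

/-- For `u ∈ W`, the character `z ↦ (-1)^{z · u}` is constant on the cosets of `W^⊥`, and its sum
over a set of representatives vanishes unless `u = 0`. -/
lemma IsCosetReps.sum_zmodSign {n : ℕ} {W : F2Subspace n} {S : Finset (F2Vec n)}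
    (hS : IsCosetReps (dualSpace W) S) {u : F2Vec n} (hu : u ∈ W) :
    ∑ z ∈ S, zmodSign (z ⬝ᵥ u) = if u = 0 then (S.card : ℂ) else 0 := by
  split_ifs with h
  · simp [h, zmodSign_zero]
  · have := hS.card_smul_sum (fun z ↦ zmodSign (z ⬝ᵥ u)) fun z w hw ↦ by
      rw [add_dotProduct, hw u hu, add_zero]
    rw [sum_zmodSign_dotProduct h, smul_eq_zero] at this
    exact this.resolve_left Nat.card_pos.ne'

open Classical in
lemma cosetState_apply {m : ℕ} (W : Grass (m + m) m) (x z v : F2Vec (m + m)) :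
    cosetState W x z v = ((1 / Real.sqrt (2 ^ m) : ℝ) : ℂ) *
      if v - x ∈ W.1 then zmodSign (z ⬝ᵥ (v - x)) else 0 := by
  unfold cosetState
  rw [Pi.smul_apply, Finset.sum_apply, smul_eq_mul, Finset.sum_filter]
  congr 1
  rw [Finset.sum_eq_single (v - x)]
  · simp [ket, zmodSign]
  · intro u _ hu
    have : v ≠ x + u := by rintro rfl; simp at hu
    simp [ket, this]
  · simp

open Classical in
/-- Averaging `|W_{x,z}⟩⟨W_{x,z}|` over `z` leaves `2^{-m}` times the diagonal projection onto the
basis vectors labelled by the coset `x + W`. -/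
lemma sum_cosetState_mul_star {m : ℕ} (W : Grass (m + m) m) {S : Finset (F2Vec (m + m))}
    (hS : IsCosetReps (dualSpace W.1) S) (x v w : F2Vec (m + m)) :
    ∑ z ∈ S, cosetState W x z v * star (cosetState W x z w) =
      if v = w then (if v - x ∈ W.1 then (S.card / 2 ^ m : ℂ) else 0) else 0 := by
  have hc : ((1 / Real.sqrt (2 ^ m) : ℝ) : ℂ) * ((1 / Real.sqrt (2 ^ m) : ℝ) : ℂ) =
      1 / 2 ^ m := by
    rw [← Complex.ofReal_mul, div_mul_div_comm, Real.mul_self_sqrt (by positivity)]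
    push_cast
    ring
  simp_rw [cosetState_apply]
  by_cases hv : v - x ∈ W.1
  · by_cases hw : w - x ∈ W.1
    · have hvw : v - x + (w - x) ∈ W.1 := W.1.add_mem hv hw
      -- In characteristic two, signs do not matter and the two copies of `x` cancel.
      have h2 : v - x + (w - x) = v - w := by
        ext i
        simp only [Pi.add_apply, Pi.sub_apply]
        generalize v i = a, w i = b, x i = c
        revert a b c
        decide
      have hterm : ∀ z ∈ S, ((1 / Real.sqrt (2 ^ m) : ℝ) : ℂ) * zmodSign (z ⬝ᵥ (v - x)) *
          star (((1 / Real.sqrt (2 ^ m) : ℝ) : ℂ) * zmodSign (z ⬝ᵥ (w - x))) =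
            1 / 2 ^ m * zmodSign (z ⬝ᵥ (v - x + (w - x))) := by
        intro z _
        rw [dotProduct_add, zmodSign_add, ← hc, star_mul', star_zmodSign, Complex.star_def,
          Complex.conj_ofReal]
        ring
      simp only [hv, hw, if_true]
      rw [Finset.sum_congr rfl hterm, ← Finset.mul_sum, hS.sum_zmodSign hvw, h2]
      simp only [sub_eq_zero]
      split_ifs
      · ring
      · simp
    · have : v ≠ w := by rintro rfl; exact hw hv
      simp [hw, this]
  · simp [hv]

/-! ### Dropping Charlie -/

lemma trace_mul_ketBra {n : ℕ} (M : Matrix (F2Vec n) (F2Vec n) ℂ) (ψ : F2Vec n → ℂ) :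
    Matrix.trace (M * ketBra ψ) = star ψ ⬝ᵥ M *ᵥ ψ := by
  rw [ketBra, Matrix.mul_vecMulVec, Matrix.trace_vecMulVec, dotProduct_comm]

lemma tensorOp_posSemidef {m : ℕ} {B C : Matrix (F2Vec m) (F2Vec m) ℂ} (hB : B.PosSemidef)
    (hC : C.PosSemidef) : (tensorOp B C).PosSemidef := by
  rw [tensorOp, Matrix.reindex_apply]
  exact (hB.kronecker hC).submatrix _

lemma tensorOp_sub {m : ℕ} (B C D : Matrix (F2Vec m) (F2Vec m) ℂ) :
    tensorOp B (C - D) = tensorOp B C - tensorOp B D := by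
  ext i j
  simp [tensorOp, Matrix.kroneckerMap_apply, mul_sub]

lemma POVM.one_sub_effect_posSemidef {n : ℕ} {ι : Type} [Fintype ι] (P : POVM n ι) (i : ι) :
    (1 - P.effect i).PosSemidef := by
  classical
  rw [← P.sum_eq_one, ← Finset.add_sum_erase _ _ (Finset.mem_univ i), add_sub_cancel_left]
  exact Matrix.posSemidef_sum _ fun j _ ↦ P.posSemidef j

/-- Ignoring Charlie's answer does not decrease the probability of winning. -/
lemma condWinProb_le {m : ℕ} {CS : F2Subspace (m + m) → Finset (F2Vec (m + m))}
    (S : Strategy m CS) (W : Grass (m + m) m) (x : CS W.1) (z : CS (dualSpace W.1)) :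
    condWinProb S W x z ≤
      (Matrix.trace (tensorOp ((S.bob W).effect x) 1 * ketBra (cosetState W x.1 z.1))).re := by
  have h := (tensorOp_posSemidef ((S.bob W).posSemidef x)
    ((S.charlie W).one_sub_effect_posSemidef z)).dotProduct_mulVec_nonneg
      (cosetState W x.1 z.1)
  rw [← trace_mul_ketBra, tensorOp_sub, sub_mul, Matrix.trace_sub] at h
  have := (Complex.le_def.1 h).1
  rw [Complex.sub_re, Complex.zero_re] at this
  exact sub_nonneg.1 this

open Classical in
lemma sum_trace_mul_ketBra_cosetState {m : ℕ} (W : Grass (m + m) m)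
    {S : Finset (F2Vec (m + m))} (hS : IsCosetReps (dualSpace W.1) S) (x : F2Vec (m + m))
    (M : Matrix (F2Vec (m + m)) (F2Vec (m + m)) ℂ) :
    ∑ z ∈ S, Matrix.trace (M * ketBra (cosetState W x z)) =
      (S.card / 2 ^ m : ℂ) * ∑ v, if v - x ∈ W.1 then M v v else 0 := by
  have hexp : ∀ z, Matrix.trace (M * ketBra (cosetState W x z)) =
      ∑ v, ∑ w, M v w * (cosetState W x z w * star (cosetState W x z v)) := fun z ↦ by
    simp [Matrix.trace, Matrix.mul_apply, ketBra, Matrix.vecMulVec_apply]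
  simp_rw [hexp]
  rw [Finset.sum_comm, Finset.mul_sum]
  refine Finset.sum_congr rfl fun v _ ↦ ?_
  rw [Finset.sum_comm]
  simp_rw [← Finset.mul_sum, sum_cosetState_mul_star W hS]
  simp [mul_comm]

/-! ### Bob guesses the coset -/

/-- For fixed `a`, at most `cardTail W` vectors `b` put `(a, b)` into a given coset of `W`. -/
lemma card_append_sub_mem_le {m : ℕ} (W : Grass (m + m) m) (x : F2Vec (m + m)) (a : F2Vec m) :
    Nat.card {b : F2Vec m // Fin.append a b - x ∈ W.1} ≤ cardTail W := by
  rcases isEmpty_or_nonempty {b : F2Vec m // Fin.append a b - x ∈ W.1} with h | ⟨⟨b₀, h₀⟩⟩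
  · simp
  · refine Nat.card_le_card_of_injective (fun b ↦ ⟨b.1 - b₀, ?_⟩) fun b c h ↦ ?_
    · have h := W.1.sub_mem b.2 h₀
      rw [sub_sub_sub_cancel_right] at h
      convert h using 1
      ext i
      refine Fin.addCases (fun i ↦ ?_) (fun i ↦ ?_) i
      · simp only [Pi.sub_apply, Fin.append_left, sub_self, Pi.zero_apply]
      · simp only [Pi.sub_apply, Fin.append_right]
    · exact Subtype.ext (sub_left_injective (Subtype.mk.inj h))

open Classical in
/-- The success probability (up to normalization) of Bob guessing the coset `x + W` from the first
half of one of its elements. -/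
lemma sum_bob_le {m : ℕ} {CS : F2Subspace (m + m) → Finset (F2Vec (m + m))}
    (S : Strategy m CS) (W : Grass (m + m) m) :
    ∑ x : CS W.1, ∑ v, (if v - x.1 ∈ W.1 then tensorOp ((S.bob W).effect x) 1 v v else 0).re ≤
      2 ^ m * cardTail W := by
  have hdiag : ∀ x a, 0 ≤ ((S.bob W).effect x a a).re := fun x a ↦
    (Complex.le_def.1 ((S.bob W).posSemidef x).diag_nonneg).1
  have hone : ∀ a, ∑ x, ((S.bob W).effect x a a).re = 1 := fun a ↦ by
    rw [← Complex.re_sum, ← Matrix.sum_apply, (S.bob W).sum_eq_one, Matrix.one_apply_eq,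
      Complex.one_re]
  calc _ = ∑ x : CS W.1, ∑ a, ∑ b, if Fin.append a b - x.1 ∈ W.1 then
          ((S.bob W).effect x a a).re else 0 := by
        refine Finset.sum_congr rfl fun x _ ↦ ?_
        rw [← Equiv.sum_comp (Fin.appendEquiv m m), Fintype.sum_prod_type]
        refine Finset.sum_congr rfl fun a _ ↦ Finset.sum_congr rfl fun b _ ↦ ?_
        rw [apply_ite Complex.re]
        simp [tensorOp, Matrix.kroneckerMap_apply, Fin.appendEquiv]
    _ ≤ ∑ x : CS W.1, ∑ a, cardTail W * ((S.bob W).effect x a a).re := by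
        refine Finset.sum_le_sum fun x _ ↦ Finset.sum_le_sum fun a _ ↦ ?_
        rw [← Finset.sum_filter, Finset.sum_const, nsmul_eq_mul, ← Fintype.card_subtype,
          ← Nat.card_eq_fintype_card]
        exact mul_le_mul_of_nonneg_right (Nat.cast_le.2 (card_append_sub_mem_le W x.1 a))
          (hdiag x a)
    _ = 2 ^ m * cardTail W := by
        rw [Finset.sum_comm]
        simp_rw [← Finset.mul_sum, hone]
        simp [mul_comm]

lemma sum_condWinProb_le {m : ℕ} {CS : F2Subspace (m + m) → Finset (F2Vec (m + m))}
    (hCS : ∀ U : F2Subspace (m + m), IsCosetReps U (CS U)) (S : Strategy m CS)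
    (W : Grass (m + m) m) :
    ∑ x : CS W.1, ∑ z : CS (dualSpace W.1), condWinProb S W x z ≤
      (CS (dualSpace W.1)).card * cardTail W := by
  classical
  have hx : ∀ x : CS W.1, ∑ z : CS (dualSpace W.1), condWinProb S W x z ≤
      (CS (dualSpace W.1)).card / 2 ^ m *
        ∑ v, (if v - x.1 ∈ W.1 then tensorOp ((S.bob W).effect x) 1 v v else 0).re := by
    intro x
    refine (Finset.sum_le_sum fun z _ ↦ condWinProb_le S W x z).trans_eq ?_
    rw [← Complex.re_sum, Finset.sum_coe_sort (CS (dualSpace W.1)) fun z ↦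
        Matrix.trace (tensorOp ((S.bob W).effect x) 1 * ketBra (cosetState W x.1 z)),
      sum_trace_mul_ketBra_cosetState W (hCS _), ← Complex.re_sum, ← Complex.re_ofReal_mul]
    push_cast
    rfl
  refine (Finset.sum_le_sum fun x _ ↦ hx x).trans ?_
  rw [← Finset.mul_sum]
  refine (mul_le_mul_of_nonneg_left (sum_bob_le S W) (by positivity)).trans_eq ?_
  field_simp

lemma winProb_le {m : ℕ} {CS : F2Subspace (m + m) → Finset (F2Vec (m + m))}
    (hCS : ∀ U : F2Subspace (m + m), IsCosetReps U (CS U)) (S : Strategy m CS) :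
    winProb S ≤ 2 / (2 ^ m + 1) := by
  have hcard : ∀ W : Grass (m + m) m, (CS W.1).card = 2 ^ m := fun W ↦ by
    have h := (hCS W.1).card_mul
    rw [card_of_finrank_eq, pow_add] at h
    exact Nat.eq_of_mul_eq_mul_left (by positivity) h
  have hW : ∀ W : Grass (m + m) m, 1 / (((CS W.1).card : ℝ) * ((CS (dualSpace W.1)).card : ℝ)) *
      ∑ x : CS W.1, ∑ z : CS (dualSpace W.1), condWinProb S W x z ≤ cardTail W / 2 ^ m := by
    intro W
    have hpos : (0 : ℝ) < (CS (dualSpace W.1)).card := Nat.cast_pos.2 (hCS _).nonempty.card_pos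
    refine (mul_le_mul_of_nonneg_left (sum_condWinProb_le hCS S W) (by positivity)).trans_eq ?_
    rw [hcard W]
    push_cast
    field_simp
  refine (mul_le_mul_of_nonneg_left (Finset.sum_le_sum fun W _ ↦ hW W) (by positivity)).trans ?_
  rw [← Finset.sum_div]
  have hsum := sum_cardTail m
  -- Splitting off the (impossible) case of an empty Grassmannian spares a proof of nonemptiness.
  rcases (Nat.cast_nonneg (α := ℝ) (Fintype.card (Grass (m + m) m))).eq_or_lt with h | h
  · rw [← h, div_zero, zero_mul]
    positivity
  · rw [le_div_iff₀ (by positivity)]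
    field_simp
    linarith

/-! ### Existence of strategies -/

/-- The POVM that always has the same outcome. -/
noncomputable def POVM.const (n : ℕ) {ι : Type} [Fintype ι] [DecidableEq ι] (i : ι) : POVM n ι where
  effect := Pi.single i 1
  posSemidef j := by
    rcases eq_or_ne j i with rfl | h
    · rw [Pi.single_eq_same]; exact Matrix.PosSemidef.one
    · rw [Pi.single_eq_of_ne h]; exact Matrix.PosSemidef.zero
  sum_eq_one := Finset.sum_pi_single' i 1 _ |>.trans (if_pos (Finset.mem_univ i))

lemma nonempty_strategy {m : ℕ} {CS : F2Subspace (m + m) → Finset (F2Vec (m + m))}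
    (hCS : ∀ U : F2Subspace (m + m), IsCosetReps U (CS U)) : Nonempty (Strategy m CS) := by
  classical
  have h : ∀ U, Nonempty (CS U) := fun U ↦ (hCS U).nonempty.to_subtype
  exact ⟨⟨fun W ↦ POVM.const m (Classical.choice (h W.1)),
    fun W ↦ POVM.const m (Classical.choice (h (dualSpace W.1)))⟩⟩

theorem theorem1 :
    (∀ (m : ℕ) (CS : F2Subspace (m + m) → Finset (F2Vec (m + m))),
      (∀ U : F2Subspace (m + m), IsCosetReps U (CS U)) →
        IsLUB (Set.range fun S : Strategy m CS => winProb S) (optWinProb m CS) ∧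
          optWinProb m CS ≤ cosetBound m) ∧
    cosetBound =Θ[atTop] (fun m : ℕ => (1 : ℝ) / 2 ^ m) := by
  refine ⟨fun m CS hCS ↦ ?_, cosetBound_isTheta⟩
  have := nonempty_strategy hCS
  have hub : cosetBound m ∈ upperBounds (Set.range fun S : Strategy m CS => winProb S) := by
    rintro _ ⟨S, rfl⟩
    exact (winProb_le hCS S).trans_eq (cosetBound_eq m).symm
  have hlub := isLUB_csSup (Set.range_nonempty fun S : Strategy m CS => winProb S) ⟨_, hub⟩
  exact ⟨hlub, hlub.2 hub⟩
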